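/- For positive integers $m,n$ and $\theta=(\alpha_1,\dots,\alpha_m,\beta_1,\dots,\beta_{n-1})\in\mathbb{R}^{m+n-1}$, put $\beta_n=0$, $\|\theta\|_\infty=\max_k|\theta_k|$, and let $\mathbb{P}_\theta$ be the law of a random matrix $X=(x_{i,j})\in\{0,1\}^{m\times n}$ whose entries are independent Bernoulli variables with \[\mathbb{P}_\theta(x_{i,j}=1)=\frac{e^{\alpha_i+\beta_j}}{1+e^{\alpha_i+\beta_j}}.\] With $d_i=\sum_{j=1}^n x_{i,j}$ and $b_j=\sum_{i=1}^m x_{i,j}$, the log-likelihood is \[\ell(\theta)=\sum_{i=1}^m\alpha_i d_i+\sum_{j=1}^{n}\beta_j b_j-\sum_{i=1}^m\sum_{j=1}^n\log\bigl(1+e^{\alpha_i+\beta_j}\bigr),\] and a maximum likelihood estimate (MLE) is a maximizer of $\ell$ over $\mathbb{R}^{m+n-1}$. **Theorem.** Let $\tau\in(0,1/24)$ be a constant, let $m=m_n$ be a sequence such that $m$ is of the same order as $n$, i.e. $c\le m/n\le C$ for all large $n$ with constants $0<c\le C<\infty$, and let $\theta^*=\theta^*_n\in\mathbb{R}^{m+n-1}$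 satisfy $\|\theta^*\|_\infty\le\tau\log n$ for all large $n$. Let $X\sim\mathbb{P}_{\theta^*}$. Then, as $n\to\infty$, the probability that an MLE exists tends to one, and, with $\widehat\theta$ denoting the MLE when it exists (and an arbitrary vector otherwise), \[\|\widehat\theta-\theta^*\|_\infty=O_p\!\left(\frac{(\log n)^{1/2}e^{6\|\theta^*\|_\infty}}{n^{1/2}}\right)=o_p(1),\] where the rate in parentheses itself tends to $0$. Moreover, for all $m,n\ge1$ and every observed matrix in $\{0,1\}^{m\times n}$, if an MLE exists, it is unique. -/

import Mathlib

open MeasureTheory ProbabilityTheory Filter Topology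

noncomputable section

namespace Affiliation

/-- The `m × n` affiliation matrices with entries in `{0, 1}` (`true` stands for `1`). -/
abbrev Graph (m n : ℕ) : Type := Fin m × Fin n → Bool

/-- The parameter vectors `θ = (α₁, …, α_m, β₁, …, β_{n-1})` in `ℝ^{m+n-1}`.
The norm of this function space is the maximum norm `‖θ‖_∞`. -/
abbrev Param (m n : ℕ) : Type := Fin m ⊕ Fin (n - 1) → ℝ

variable {m n : ℕ}

/-- The coordinate `α_i`. -/
def alpha (θ : Param m n) (i : Fin m) : ℝ := θ (Sum.inl i)

/-- The coordinate `β_j`; the last one, `β_n`, is zero by convention. -/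
def beta (θ : Param m n) (j : Fin n) : ℝ :=
  if h : j.1 < n - 1 then θ (Sum.inr ⟨j.1, h⟩) else 0

/-- The entry `x_{i,j}` as a real number. -/
def entry (x : Graph m n) (i : Fin m) (j : Fin n) : ℝ := if x (i, j) then 1 else 0

/-- The row sum `d_i`. -/
def rowDegree (x : Graph m n) (i : Fin m) : ℝ := ∑ j, entry x i j

/-- The column sum `b_j`. -/
def colDegree (x : Graph m n) (j : Fin n) : ℝ := ∑ i, entry x i j

/-- The log-likelihood `∑ α_i d_i + ∑ β_j b_j - ∑ log (1 + exp (α_i + β_j))`. -/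
def logLikelihood (x : Graph m n) (θ : Param m n) : ℝ :=
  ∑ i, alpha θ i * rowDegree x i + ∑ j, beta θ j * colDegree x j
    - ∑ i, ∑ j, Real.log (1 + Real.exp (alpha θ i + beta θ j))

/-- `θ` is a maximum likelihood estimate from the observation `x`. -/
def IsMLE (x : Graph m n) (θ : Param m n) : Prop :=
  ∀ θ' : Param m n, logLikelihood x θ' ≤ logLikelihood x θ

/-- The law of the affiliation matrix under `θ`: the entries are independent, and `x_{i,j}` is
Bernoulli with success probability `exp (α_i + β_j) / (1 + exp (α_i + β_j))`. -/
def law (θ : Param m n) : Measure (Graph m n) :=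
  Measure.pi fun p : Fin m × Fin n =>
    bernoulliMeasure true false (unitInterval.sigmoid (alpha θ p.1 + beta θ p.2))

instance (θ : Param m n) : IsProbabilityMeasure (law θ) := by
  unfold law; infer_instance

/-- The law in exponential form: the likelihood is the probability of the observation. -/
theorem law_singleton (θ : Param m n) (x : Graph m n) :
    law θ {x} = ENNReal.ofReal (Real.exp (logLikelihood x θ)) := by
  have key : ∀ (t : ℝ) (b : Bool),
      bernoulliMeasure true false (unitInterval.sigmoid t) {b}
        = ENNReal.ofReal (Real.exp (t * (if b then 1 else 0) - Real.log (1 + Real.exp t))) := by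
    intro t b
    have hpos : 0 < 1 + Real.exp t := by positivity
    have hsig : Real.sigmoid t = Real.exp t / (1 + Real.exp t) := by
      rw [Real.sigmoid_def, Real.exp_neg]
      field_simp
      ring
    have hcoe : ∀ p : unitInterval,
        ((unitInterval.toNNReal p : NNReal) : ENNReal) = ENNReal.ofReal (p : ℝ) := fun p =>
      (ENNReal.ofReal_eq_coe_nnreal p.2.1).symm
    have hval : ((unitInterval.sigmoid t : unitInterval) : ℝ) = Real.sigmoid t := rfl
    rw [Real.exp_sub, Real.exp_log hpos]
    cases b
    · simp only [bernoulliMeasure_def]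
      simp [hcoe, hval, hsig]
      congr 1
      field_simp
      ring
    · simp [bernoulliMeasure_def, hcoe, hval, hsig]
  have hsum : logLikelihood x θ = ∑ p : Fin m × Fin n,
      ((alpha θ p.1 + beta θ p.2) * (if x p then 1 else 0)
        - Real.log (1 + Real.exp (alpha θ p.1 + beta θ p.2))) := by
    rw [Fintype.sum_prod_type]
    simp only [logLikelihood, rowDegree, colDegree, entry, Finset.sum_sub_distrib, add_mul,
      Finset.sum_add_distrib, Finset.mul_sum]
    rw [Finset.sum_comm (f := fun (j : Fin n) (i : Fin m) => beta θ j * _)]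
  rw [law, Measure.pi_singleton, hsum, Real.exp_sum,
    ENNReal.ofReal_prod_of_nonneg fun _ _ => (Real.exp_pos _).le]
  exact Finset.prod_congr rfl fun p _ => key _ _

end Affiliation

/-- `Y_n = O_p(a_n)`, where `Y_n` is a real random variable on the probability space
`(Ω n, P n)` and `a_n` is a deterministic nonnegative sequence. -/
def IsBigOInProbability {Ω : ℕ → Type*} [∀ n, MeasurableSpace (Ω n)] (P : ∀ n, Measure (Ω n))
    (Y : ∀ n, Ω n → ℝ) (a : ℕ → ℝ) : Prop :=
  ∀ ε : ℝ, 0 < ε → ∃ M : ℝ, 0 < M ∧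
    ∀ᶠ n in atTop, P n {ω | M * a n < |Y n ω|} ≤ ENNReal.ofReal ε

/-- `Y_n = o_p(a_n)`. -/
def IsLittleOInProbability {Ω : ℕ → Type*} [∀ n, MeasurableSpace (Ω n)] (P : ∀ n, Measure (Ω n))
    (Y : ∀ n, Ω n → ℝ) (a : ℕ → ℝ) : Prop :=
  ∀ δ : ℝ, 0 < δ → Tendsto (fun n => P n {ω | δ * a n < |Y n ω|}) atTop (𝓝 0)

end

/-! The likelihood only depends on the sums `α_i + β_j`, so it may be studied on `ℝ^m × ℝ^n`, where
rows and columns play symmetric roles and the convention `β_n = 0` merely selects a representative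
modulo the shift `(α + c, β - c)`.

Maximise it over the sup-norm box of radius `R` around the true parameter. By the mean value theorem
the increment of each success probability is a weight, comparable to `e^{-2‖θ*‖}`, times the
increment `u_i + v_j` of the predictor, and the first-order conditions bound the row and column sums
of these increments by the size `D` of the residual sums, except where a face of the box compensates
them. If `R` exceeds a multiple of `e^{4‖θ*‖} D / min (m, n)`, averaging over rows and columns shows
that the maximiser cannot touch both a face `u_i = R` or `v_j = -R` and a face `u_i = -R` or
`v_j = R`. A small shift then moves it into the open box without changing the likelihood, and by
concavity it is a global maximiser. Hoeffding's inequality and a union bound give `D` of order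
`√(n log n)`. -/

/-! ### The logistic function -/

theorem hasDerivAt_log_one_add_exp (t : ℝ) :
    HasDerivAt (fun t ↦ Real.log (1 + Real.exp t)) (Real.sigmoid t) t := by
  convert ((Real.hasDerivAt_exp t).const_add 1).log (by positivity) using 1
  rw [Real.sigmoid_def, Real.exp_neg]
  field_simp
  ring

theorem convexOn_log_one_add_exp :
    ConvexOn ℝ Set.univ (fun t ↦ Real.log (1 + Real.exp t)) := by
  refine Monotone.convexOn_univ_of_deriv
    (fun t ↦ (hasDerivAt_log_one_add_exp t).differentiableAt) ?_
  rw [funext fun t ↦ (hasDerivAt_log_one_add_exp t).deriv]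
  exact Real.sigmoid_monotone

theorem exp_neg_abs_div_four_le_deriv_sigmoid (t : ℝ) :
    Real.exp (-|t|) / 4 ≤ deriv Real.sigmoid t := by
  have hsymm : deriv Real.sigmoid t = Real.sigmoid |t| * Real.sigmoid (-|t|) := by
    simp only [Real.deriv_sigmoid, ← Real.sigmoid_neg]
    rcases abs_choice t with h | h <;> rw [h]
    rw [neg_neg, mul_comm]
  have hhalf : 2⁻¹ ≤ Real.sigmoid |t| := Real.sigmoid_zero ▸ Real.sigmoid_le (abs_nonneg t)
  calc Real.exp (-|t|) / 4 = 2⁻¹ * (2⁻¹ * Real.exp (-|t|)) := by ring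
    _ ≤ Real.sigmoid |t| * (Real.sigmoid |t| * Real.exp (-|t|)) := by gcongr
    _ = deriv Real.sigmoid t := by rw [hsymm, Real.sigmoid_mul_rexp_neg]

theorem deriv_sigmoid_le_one (t : ℝ) : deriv Real.sigmoid t ≤ 1 := by
  rw [Real.deriv_sigmoid]
  nlinarith [Real.sigmoid_pos t, Real.sigmoid_lt_one t]

theorem exists_sigmoid_sub_eq_mul {B s t : ℝ} (hs : |s| ≤ B) (ht : |t| ≤ B) :
    ∃ w ∈ Set.Icc (Real.exp (-B) / 4) 1, Real.sigmoid t - Real.sigmoid s = w * (t - s) := by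
  have hderiv : ∀ c, |c| ≤ B → deriv Real.sigmoid c ∈ Set.Icc (Real.exp (-B) / 4) 1 := fun c hc ↦
    ⟨le_trans (by gcongr) (exp_neg_abs_div_four_le_deriv_sigmoid c), deriv_sigmoid_le_one c⟩
  wlog hst : s ≤ t generalizing s t
  · obtain ⟨w, hw, h⟩ := this ht hs (le_of_not_ge hst)
    exact ⟨w, hw, by linarith⟩
  rcases hst.eq_or_lt with rfl | hlt
  · exact ⟨_, hderiv s hs, by simp⟩
  obtain ⟨c, hc, hslope⟩ := exists_deriv_eq_slope Real.sigmoid hlt continuous_sigmoid.continuousOn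
    differentiable_sigmoid.differentiableOn
  refine ⟨_, hderiv c (abs_le.2 ⟨?_, ?_⟩), ?_⟩
  · exact (neg_le_of_abs_le hs).trans hc.1.le
  · exact hc.2.le.trans (le_of_abs_le ht)
  · rw [hslope, div_mul_cancel₀ _ (sub_pos.2 hlt).ne']

/-! ### Equilibria in a box -/

theorem exists_shift_abs_lt_of_lt {ι κ : Type*} [Finite ι] [Finite κ] {R : ℝ} {u : ι → ℝ}
    {v : κ → ℝ} (hu : ∀ i, |u i| ≤ R) (hv : ∀ j, |v j| ≤ R) (hu' : ∀ i, u i < R)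
    (hv' : ∀ j, -R < v j) :
    ∃ c, (∀ i, |u i + c| < R) ∧ ∀ j, |v j - c| < R := by
  have hleft : ∀ᶠ c in 𝓝[>] (0 : ℝ), ∀ i, u i < R - c := by
    refine eventually_all.2 fun i ↦ eventually_nhdsWithin_of_eventually_nhds ?_
    exact (by fun_prop : Continuous fun c ↦ R - c).continuousAt.eventually_const_lt
      (by simpa using hu' i)
  have hright : ∀ᶠ c in 𝓝[>] (0 : ℝ), ∀ j, c - R < v j := by
    refine eventually_all.2 fun j ↦ eventually_nhdsWithin_of_eventually_nhds ?_
    exact (by fun_prop : Continuous fun c ↦ c - R).continuousAt.eventually_lt_const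
      (by simpa using hv' j)
  obtain ⟨c, hcu, hcv, hc : 0 < c⟩ := (hleft.and (hright.and self_mem_nhdsWithin)).exists
  refine ⟨c, fun i ↦ abs_lt.2 ?_, fun j ↦ abs_lt.2 ?_⟩
  · constructor <;> linarith [hcu i, (abs_le.1 (hu i)).1]
  · constructor <;> linarith [hcv j, (abs_le.1 (hv j)).2]

section Box

variable {ι κ : Type*} [Fintype ι] [Fintype κ]

/-- Potentials `u` and `v` on the two sides of a complete bipartite network, confined to the box of
radius `R`. The edge `(i, j)` carries the flow `w i j * (u i + v j)`, and the net flow through a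
vertex lies in `[-D, D]`, except that the upper bound may fail where the potential is `-R` and the
lower bound where it is `R`. This is what the first-order conditions say about the difference
between the maximiser of the likelihood over a box and the centre of the box. -/
structure IsBoxEquilibrium (q D R : ℝ) (w : ι → κ → ℝ) (u : ι → ℝ) (v : κ → ℝ) : Prop where
  ratio_pos : 0 < q
  radius_pos : 0 < R
  weight_mem : ∀ i j, w i j ∈ Set.Icc q 1
  abs_left_le : ∀ i, |u i| ≤ R
  abs_right_le : ∀ j, |v j| ≤ R
  row_le : ∀ i, -R < u i → ∑ j, w i j * (u i + v j) ≤ D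
  le_row : ∀ i, u i < R → -D ≤ ∑ j, w i j * (u i + v j)
  col_le : ∀ j, -R < v j → ∑ i, w i j * (u i + v j) ≤ D
  le_col : ∀ j, v j < R → -D ≤ ∑ i, w i j * (u i + v j)

namespace IsBoxEquilibrium

variable {q D R k : ℝ} {w : ι → κ → ℝ} {u : ι → ℝ} {v : κ → ℝ}

theorem swap (H : IsBoxEquilibrium q D R w u v) :
    IsBoxEquilibrium q D R (fun j i ↦ w i j) v u where
  ratio_pos := H.ratio_pos
  radius_pos := H.radius_pos
  weight_mem j i := H.weight_mem i j
  abs_left_le := H.abs_right_le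
  abs_right_le := H.abs_left_le
  row_le j hj := by simpa only [add_comm] using H.col_le j hj
  le_row j hj := by simpa only [add_comm] using H.le_col j hj
  col_le i hi := by simpa only [add_comm] using H.row_le i hi
  le_col i hi := by simpa only [add_comm] using H.le_row i hi

theorem neg (H : IsBoxEquilibrium q D R w u v) : IsBoxEquilibrium q D R w (-u) (-v) where
  ratio_pos := H.ratio_pos
  radius_pos := H.radius_pos
  weight_mem := H.weight_mem
  abs_left_le i := by simpa using H.abs_left_le i
  abs_right_le j := by simpa using H.abs_right_le j
  row_le i hi := by
    simpa only [Pi.neg_apply, ← neg_add, mul_neg, Finset.sum_neg_distrib, neg_le]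
      using H.le_row i (neg_lt_neg_iff.1 hi)
  le_row i hi := by
    simpa only [Pi.neg_apply, ← neg_add, mul_neg, Finset.sum_neg_distrib, neg_le_neg_iff]
      using H.row_le i (neg_lt.1 hi)
  col_le j hj := by
    simpa only [Pi.neg_apply, ← neg_add, mul_neg, Finset.sum_neg_distrib, neg_le]
      using H.le_col j (neg_lt_neg_iff.1 hj)
  le_col j hj := by
    simpa only [Pi.neg_apply, ← neg_add, mul_neg, Finset.sum_neg_distrib, neg_le_neg_iff]
      using H.col_le j (neg_lt.1 hj)

theorem radius_add_right_nonneg (H : IsBoxEquilibrium q D R w u v) (j : κ) : 0 ≤ R + v j := by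
  linarith [neg_le_of_abs_le (H.abs_right_le j)]

theorem mul_sum_le_of_left_eq (H : IsBoxEquilibrium q D R w u v) {i : ι} (hi : u i = R) :
    q * ∑ j, (R + v j) ≤ D :=
  calc q * ∑ j, (R + v j) = ∑ j, q * (R + v j) := Finset.mul_sum ..
    _ ≤ ∑ j, w i j * (u i + v j) := by
      rw [hi]
      gcongr with j
      · exact H.radius_add_right_nonneg j
      · exact (H.weight_mem i j).1
    _ ≤ D := H.row_le i (by linarith [H.radius_pos])

theorem nonneg_of_left_eq (H : IsBoxEquilibrium q D R w u v) {i : ι} (hi : u i = R) : 0 ≤ D :=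
  (mul_nonneg H.ratio_pos.le
    (Finset.sum_nonneg fun j _ ↦ H.radius_add_right_nonneg j)).trans (H.mul_sum_le_of_left_eq hi)

theorem le_of_left_eq_of_left_eq_neg (H : IsBoxEquilibrium q D R w u v)
    (hk : k ≤ Fintype.card κ) {i i' : ι} (hi : u i = R) (hi' : u i' = -R) :
    2 * k * q ^ 2 * R ≤ 3 * D := by
  have htop : q * ∑ j, (R + v j) ≤ D := H.mul_sum_le_of_left_eq hi
  have hbot : q * ∑ j, (R + (-v) j) ≤ D :=
    H.neg.mul_sum_le_of_left_eq (i := i') (by simp [hi'])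
  have hq := H.ratio_pos
  have hR := H.radius_pos
  calc 2 * k * q ^ 2 * R ≤ 2 * Fintype.card κ * q ^ 2 * R := by gcongr
    _ = ∑ _j : κ, q * q * (2 * R) := by
      rw [Finset.sum_const, Finset.card_univ, nsmul_eq_mul]
      ring
    _ ≤ ∑ _j : κ, q * 1 * (2 * R) := by
      gcongr with j
      exact (H.weight_mem i j).1.trans (H.weight_mem i j).2
    _ = q * ∑ j, (R + v j) + q * ∑ j, (R + (-v) j) := by
      rw [← mul_add, ← Finset.sum_add_distrib, Finset.mul_sum]
      refine Finset.sum_congr rfl fun j _ ↦ ?_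
      rw [Pi.neg_apply]
      ring
    _ ≤ 3 * D := by linarith [H.nonneg_of_left_eq hi]

theorem exists_mul_radius_add_right_le (H : IsBoxEquilibrium q D R w u v) [Nonempty κ]
    (hk : k ≤ Fintype.card κ) {i : ι} (hi : u i = R) : ∃ l, k * (q * (R + v l)) ≤ D := by
  have hcard : (0 : ℝ) < Fintype.card κ := by exact_mod_cast Fintype.card_pos
  obtain ⟨l, -, hl⟩ : ∃ l ∈ Finset.univ, q * (R + v l) ≤ D / Fintype.card κ := by
    refine Finset.exists_le_of_sum_le Finset.univ_nonempty ?_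
    rw [← Finset.mul_sum, Finset.sum_const, Finset.card_univ, nsmul_eq_mul,
      mul_div_cancel₀ _ hcard.ne']
    exact H.mul_sum_le_of_left_eq hi
  have := mul_nonneg H.ratio_pos.le (H.radius_add_right_nonneg l)
  refine ⟨l, le_trans (by gcongr) ((le_div_iff₀' hcard).1 hl)⟩

theorem mul_radius_sub_right_le (H : IsBoxEquilibrium q D R w u v) (hk : k ≤ Fintype.card ι)
    (l : κ) (hl : v l < R) : k * (q * (R - v l)) ≤ ∑ i, (R + u i) + D := by
  have hsum : ∑ i, w i l * (u i + v l) ≤ ∑ i, ((R + u i) - q * (R - v l)) := by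
    gcongr with i
    have h₁ : w i l * (R + u i) ≤ 1 * (R + u i) :=
      mul_le_mul_of_nonneg_right (H.weight_mem i l).2 (H.swap.radius_add_right_nonneg i)
    have h₂ : q * (R - v l) ≤ w i l * (R - v l) :=
      mul_le_mul_of_nonneg_right (H.weight_mem i l).1 (sub_pos.2 hl).le
    linarith
  rw [Finset.sum_sub_distrib, Finset.sum_const, Finset.card_univ, nsmul_eq_mul] at hsum
  have hcard : k * (q * (R - v l)) ≤ Fintype.card ι * (q * (R - v l)) :=
    mul_le_mul_of_nonneg_right hk (mul_nonneg H.ratio_pos.le (sub_pos.2 hl).le)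
  linarith [H.le_col l hl]

/-- The row through `i` makes the right potentials close to `-R` on average and the column through
`j` does the same on the left, so that too much flow leaves through the lowest right vertex. -/
theorem le_of_left_eq_of_right_eq (H : IsBoxEquilibrium q D R w u v) (hkι : k ≤ Fintype.card ι)
    (hkκ : k ≤ Fintype.card κ) {i : ι} {j : κ} (hi : u i = R) (hj : v j = R) :
    2 * k * q ^ 2 * R ≤ 3 * D := by
  have : Nonempty κ := ⟨j⟩
  have hq := H.ratio_pos
  have hq1 : q ≤ 1 := (H.weight_mem i j).1.trans (H.weight_mem i j).2
  have hD : 0 ≤ D := H.nonneg_of_left_eq hi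
  have hqD : q * D ≤ D := mul_le_of_le_one_left hD hq1
  have hcol : q * ∑ i, (R + u i) ≤ D := H.swap.mul_sum_le_of_left_eq hj
  obtain ⟨l, hlow⟩ := H.exists_mul_radius_add_right_le hkκ hi
  have hhigh : q * (k * (q * (R - v l))) ≤ D + q * D := by
    rcases (le_of_abs_le (H.abs_right_le l)).lt_or_eq with hl | hl
    · have := mul_le_mul_of_nonneg_left (H.mul_radius_sub_right_le hkι l hl) hq.le
      linarith
    · rw [hl, sub_self, mul_zero, mul_zero, mul_zero]
      positivity
  calc 2 * k * q ^ 2 * R = q * (k * (q * (R + v l))) + q * (k * (q * (R - v l))) := by ring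
    _ ≤ q * D + (D + q * D) := by gcongr
    _ ≤ 3 * D := by linarith

theorem not_touch_opposite_faces (H : IsBoxEquilibrium q D R w u v) (hkι : k ≤ Fintype.card ι)
    (hkκ : k ≤ Fintype.card κ) (hD : 3 * D < 2 * k * q ^ 2 * R) :
    (∀ i, u i < R) ∧ (∀ j, -R < v j) ∨ (∀ i, -R < u i) ∧ (∀ j, v j < R) := by
  have hu (i) := abs_le.1 (H.abs_left_le i)
  have hv (j) := abs_le.1 (H.abs_right_le j)
  by_contra! hcon
  obtain ⟨h₁, h₂⟩ := hcon
  have htop : (∃ i, u i = R) ∨ ∃ j, v j = -R := by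
    by_contra! h
    obtain ⟨j, hj⟩ := h₁ fun i ↦ (hu i).2.lt_of_ne (h.1 i)
    exact h.2 j (hj.antisymm (hv j).1)
  have hbot : (∃ i, u i = -R) ∨ ∃ j, v j = R := by
    by_contra! h
    obtain ⟨j, hj⟩ := h₂ fun i ↦ (hu i).1.lt_of_ne' (h.1 i)
    exact h.2 j ((hv j).2.antisymm hj)
  refine hD.not_ge ?_
  rcases htop with ⟨i, hi⟩ | ⟨j, hj⟩ <;> rcases hbot with ⟨i', hi'⟩ | ⟨j', hj'⟩
  · exact H.le_of_left_eq_of_left_eq_neg hkκ hi hi'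
  · exact H.le_of_left_eq_of_right_eq hkι hkκ hi hj'
  · exact H.neg.le_of_left_eq_of_right_eq hkι hkκ (i := i') (j := j) (by simp [hi']) (by simp [hj])
  · exact H.swap.le_of_left_eq_of_left_eq_neg hkι hj' hj

theorem exists_shift_abs_lt (H : IsBoxEquilibrium q D R w u v) (hkι : k ≤ Fintype.card ι)
    (hkκ : k ≤ Fintype.card κ) (hD : 3 * D < 2 * k * q ^ 2 * R) :
    ∃ c, (∀ i, |u i + c| < R) ∧ ∀ j, |v j - c| < R := by
  rcases H.not_touch_opposite_faces hkι hkκ hD with ⟨hu, hv⟩ | ⟨hu, hv⟩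
  · exact exists_shift_abs_lt_of_lt H.abs_left_le H.abs_right_le hu hv
  · obtain ⟨c, hcv, hcu⟩ := exists_shift_abs_lt_of_lt H.abs_right_le H.abs_left_le hv hu
    exact ⟨-c, by simpa only [← sub_eq_add_neg] using hcu, by simpa only [sub_neg_eq_add] using hcv⟩

end IsBoxEquilibrium

end Box

/-! ### The likelihood of a logistic array -/

theorem concaveOn_sum {𝕜 E β ι : Type*} [Semiring 𝕜] [PartialOrder 𝕜] [AddCommMonoid E]
    [AddCommMonoid β] [PartialOrder β] [IsOrderedAddMonoid β] [SMul 𝕜 E] [Module 𝕜 β] {s : Set E}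
    (hs : Convex 𝕜 s) {t : Finset ι} {f : ι → E → β} (hf : ∀ i ∈ t, ConcaveOn 𝕜 s (f i)) :
    ConcaveOn 𝕜 s fun x ↦ ∑ i ∈ t, f i x := by
  rw [← Finset.sum_fn]
  exact Finset.sum_induction f (ConcaveOn 𝕜 s) (fun _ _ ↦ ConcaveOn.add)
    (concaveOn_const 0 hs) hf

section Likelihood

variable {ι κ : Type*} {R : ℝ} {p p₀ z : (ι → ℝ) × (κ → ℝ)}

/-- The linear predictor `α_i + β_j` of the entry `(i, j)`, as a functional of `p = (α, β)`. -/
def predictor (i : ι) (j : κ) : ((ι → ℝ) × (κ → ℝ)) →L[ℝ] ℝ :=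
  .proj (φ := fun _ : ι ↦ ℝ) i ∘L .fst ℝ _ _ + .proj (φ := fun _ : κ ↦ ℝ) j ∘L .snd ℝ _ _

@[simp]
theorem predictor_apply (i : ι) (j : κ) (p : (ι → ℝ) × (κ → ℝ)) :
    predictor i j p = p.1 i + p.2 j := rfl

/-- The amount by which the entry `(i, j)` of `y` exceeds its mean in the logistic model with
effects `p`. -/
noncomputable def logisticResidual (y : ι → κ → ℝ) (p : (ι → ℝ) × (κ → ℝ)) (i : ι) (j : κ) : ℝ :=
  y i j - Real.sigmoid (predictor i j p)

/-- The vector `(α + c, β - c)`, which has the same predictors as `p = (α, β)`. -/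
def shift (c : ℝ) (p : (ι → ℝ) × (κ → ℝ)) : (ι → ℝ) × (κ → ℝ) :=
  (fun i ↦ p.1 i + c, fun j ↦ p.2 j - c)

theorem predictor_shift (i : ι) (j : κ) (c : ℝ) (p : (ι → ℝ) × (κ → ℝ)) :
    predictor i j (shift c p) = predictor i j p := by
  simp [shift]

variable [Fintype ι] [Fintype κ]

theorem mem_closedBall_prod_pi (hR : 0 ≤ R) :
    p ∈ Metric.closedBall p₀ R ↔ (∀ i, |p.1 i - p₀.1 i| ≤ R) ∧ ∀ j, |p.2 j - p₀.2 j| ≤ R := by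
  simp [Prod.dist_eq, dist_pi_le_iff hR, Real.dist_eq]

theorem mem_ball_prod_pi (hR : 0 < R) :
    p ∈ Metric.ball p₀ R ↔ (∀ i, |p.1 i - p₀.1 i| < R) ∧ ∀ j, |p.2 j - p₀.2 j| < R := by
  simp [Prod.dist_eq, dist_pi_lt_iff hR, Real.dist_eq]

theorem abs_predictor_le (i : ι) (j : κ) (p : (ι → ℝ) × (κ → ℝ)) :
    |predictor i j p| ≤ 2 * ‖p‖ := by
  have h₁ : |p.1 i| ≤ ‖p‖ := (norm_le_pi_norm p.1 i).trans (norm_fst_le p)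
  have h₂ : |p.2 j| ≤ ‖p‖ := (norm_le_pi_norm p.2 j).trans (norm_snd_le p)
  calc |predictor i j p| ≤ |p.1 i| + |p.2 j| := abs_add_le _ _
    _ ≤ 2 * ‖p‖ := by linarith

/-- The log-likelihood of the array `y` of binary responses in the logistic model with row and
column effects `p`, without the normalization of the last column effect. -/
noncomputable def logisticLik (y : ι → κ → ℝ) (p : (ι → ℝ) × (κ → ℝ)) : ℝ :=
  ∑ i, ∑ j, (predictor i j p * y i j - Real.log (1 + Real.exp (predictor i j p)))

/-- All row sums and all column sums of the residuals at `p` are at most `D` in absolute value. -/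
def HasResidualSumsLE (y : ι → κ → ℝ) (p : (ι → ℝ) × (κ → ℝ)) (D : ℝ) : Prop :=
  (∀ i, |∑ j, logisticResidual y p i j| ≤ D) ∧ ∀ j, |∑ i, logisticResidual y p i j| ≤ D

variable {y : ι → κ → ℝ} {B D k : ℝ} {s : Set ((ι → ℝ) × (κ → ℝ))}

theorem logisticLik_shift (y : ι → κ → ℝ) (c : ℝ) (p : (ι → ℝ) × (κ → ℝ)) :
    logisticLik y (shift c p) = logisticLik y p := by
  simp only [logisticLik, predictor_shift]

theorem hasFDerivAt_logisticLik (y : ι → κ → ℝ) (p : (ι → ℝ) × (κ → ℝ)) :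
    HasFDerivAt (logisticLik y) (∑ i, ∑ j, logisticResidual y p i j • predictor i j) p := by
  refine HasFDerivAt.fun_sum fun i _ ↦ HasFDerivAt.fun_sum fun j _ ↦ ?_
  have hterm : HasDerivAt (fun t ↦ t * y i j - Real.log (1 + Real.exp t)) (logisticResidual y p i j)
      (predictor i j p) :=
    (hasDerivAt_mul_const _).sub (hasDerivAt_log_one_add_exp _)
  exact hterm.comp_hasFDerivAt p (predictor i j).hasFDerivAt

theorem continuous_logisticLik (y : ι → κ → ℝ) : Continuous (logisticLik y) :=
  continuous_iff_continuousAt.2 fun p ↦ (hasFDerivAt_logisticLik y p).continuousAt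

theorem concaveOn_logisticLik (y : ι → κ → ℝ) : ConcaveOn ℝ Set.univ (logisticLik y) := by
  have hterm (i : ι) (j : κ) : ConcaveOn ℝ Set.univ fun p : (ι → ℝ) × (κ → ℝ) ↦
      predictor i j p * y i j - Real.log (1 + Real.exp (predictor i j p)) :=
    (((LinearMap.mulRight ℝ (y i j)).concaveOn convex_univ).sub
      convexOn_log_one_add_exp).comp_linearMap (predictor i j).toLinearMap
  exact concaveOn_sum convex_univ fun i _ ↦ concaveOn_sum convex_univ fun j _ ↦ hterm i j

theorem sum_residual_mul_nonpos_of_isMaxOn (hs : Convex ℝ s) (hp : p ∈ s) (hz : z ∈ s)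
    (hmax : IsMaxOn (logisticLik y) s p) :
    ∑ i, ∑ j, logisticResidual y p i j * (predictor i j z - predictor i j p) ≤ 0 := by
  have h := hmax.localize.hasFDerivWithinAt_nonpos (hasFDerivAt_logisticLik y p).hasFDerivWithinAt
    (sub_mem_posTangentConeAt_of_segment_subset (hs.segment_subset hp hz))
  simpa only [sum_apply, smul_apply, smul_eq_mul, ← map_sub] using h

theorem mul_row_sum_residual_nonpos (hp : p ∈ Metric.closedBall p₀ R)
    (hmax : IsMaxOn (logisticLik y) (Metric.closedBall p₀ R) p) {i : ι} {t : ℝ}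
    (ht : |t - p₀.1 i| ≤ R) : (t - p.1 i) * ∑ j, logisticResidual y p i j ≤ 0 := by
  classical
  have hR : 0 ≤ R := (abs_nonneg _).trans ht
  have hz : (Function.update p.1 i t, p.2) ∈ Metric.closedBall p₀ R := by
    rw [mem_closedBall_prod_pi hR] at hp ⊢
    refine ⟨fun i' ↦ ?_, hp.2⟩
    obtain rfl | hne := eq_or_ne i' i
    · simpa using ht
    · simpa [hne] using hp.1 i'
  have h := sum_residual_mul_nonpos_of_isMaxOn (convex_closedBall p₀ R) hp hz hmax
  rw [Fintype.sum_eq_single i fun i' hne ↦ by simp [hne]] at h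
  simpa [← Finset.sum_mul, mul_comm] using h

theorem mul_col_sum_residual_nonpos (hp : p ∈ Metric.closedBall p₀ R)
    (hmax : IsMaxOn (logisticLik y) (Metric.closedBall p₀ R) p) {j : κ} {t : ℝ}
    (ht : |t - p₀.2 j| ≤ R) : (t - p.2 j) * ∑ i, logisticResidual y p i j ≤ 0 := by
  classical
  have hR : 0 ≤ R := (abs_nonneg _).trans ht
  have hz : (p.1, Function.update p.2 j t) ∈ Metric.closedBall p₀ R := by
    rw [mem_closedBall_prod_pi hR] at hp ⊢
    refine ⟨hp.1, fun j' ↦ ?_⟩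
    obtain rfl | hne := eq_or_ne j' j
    · simpa using ht
    · simpa [hne] using hp.2 j'
  have h := sum_residual_mul_nonpos_of_isMaxOn (convex_closedBall p₀ R) hp hz hmax
  rw [Finset.sum_comm, Fintype.sum_eq_single j fun j' hne ↦ by simp [hne]] at h
  simpa [← Finset.sum_mul, mul_comm] using h

theorem exists_weight_mul_eq_logisticResidual_sub (y : ι → κ → ℝ)
    (hB : ∀ i j, |predictor i j p₀| + 2 * R ≤ B) (hp : p ∈ Metric.closedBall p₀ R) (i : ι) (j : κ) :
    ∃ w ∈ Set.Icc (Real.exp (-B) / 4) 1, w * ((p.1 i - p₀.1 i) + (p.2 j - p₀.2 j)) =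
      logisticResidual y p₀ i j - logisticResidual y p i j := by
  have hR : 0 ≤ R := Metric.nonempty_closedBall.1 ⟨p, hp⟩
  have hsub : |predictor i j (p - p₀)| ≤ 2 * R :=
    (abs_predictor_le i j _).trans (by gcongr; exact mem_closedBall_iff_norm.1 hp)
  rw [map_sub] at hsub
  have habs : |predictor i j p| ≤ B := by
    linarith [abs_sub_abs_le_abs_sub (predictor i j p) (predictor i j p₀), hB i j]
  obtain ⟨w, hw, hsigmoid⟩ := exists_sigmoid_sub_eq_mul (s := predictor i j p₀)
    (by linarith [hB i j]) habs
  refine ⟨w, hw, ?_⟩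
  rw [logisticResidual, logisticResidual, sub_sub_sub_cancel_left, hsigmoid, predictor_apply,
    predictor_apply, add_sub_add_comm]

theorem exists_isBoxEquilibrium_of_isMaxOn (hR : 0 < R)
    (hB : ∀ i j, |predictor i j p₀| + 2 * R ≤ B) (hres : HasResidualSumsLE y p₀ D)
    (hp : p ∈ Metric.closedBall p₀ R)
    (hmax : IsMaxOn (logisticLik y) (Metric.closedBall p₀ R) p) :
    ∃ w, IsBoxEquilibrium (Real.exp (-B) / 4) D R w (p.1 - p₀.1) (p.2 - p₀.2) := by
  obtain ⟨hu, hv⟩ := (mem_closedBall_prod_pi hR.le).1 hp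
  choose w hw hflow using exists_weight_mul_eq_logisticResidual_sub y hB hp
  have hRR : |R| ≤ R := (abs_of_pos hR).le
  refine ⟨w, by positivity, hR, hw, hu, hv, fun i h ↦ ?_, fun i h ↦ ?_, fun j h ↦ ?_,
    fun j h ↦ ?_⟩ <;> simp only [Pi.sub_apply, hflow, Finset.sum_sub_distrib] at h ⊢
  · have := nonneg_of_mul_nonpos_right (mul_row_sum_residual_nonpos hp hmax (i := i)
      (t := p₀.1 i - R) (by simpa using hRR)) (by linarith)
    linarith [le_of_abs_le (hres.1 i)]
  · have := nonpos_of_mul_nonpos_right (mul_row_sum_residual_nonpos hp hmax (i := i)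
      (t := p₀.1 i + R) (by simpa using hRR)) (by linarith)
    linarith [neg_le_of_abs_le (hres.1 i)]
  · have := nonneg_of_mul_nonpos_right (mul_col_sum_residual_nonpos hp hmax (j := j)
      (t := p₀.2 j - R) (by simpa using hRR)) (by linarith)
    linarith [le_of_abs_le (hres.2 j)]
  · have := nonpos_of_mul_nonpos_right (mul_col_sum_residual_nonpos hp hmax (j := j)
      (t := p₀.2 j + R) (by simpa using hRR)) (by linarith)
    linarith [neg_le_of_abs_le (hres.2 j)]

theorem exists_isMaxOn_univ_mem_ball (hR : 0 < R) (hB : ∀ i j, |predictor i j p₀| + 2 * R ≤ B)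
    (hkι : k ≤ Fintype.card ι) (hkκ : k ≤ Fintype.card κ) (hres : HasResidualSumsLE y p₀ D)
    (hD : 3 * D < 2 * k * (Real.exp (-B) / 4) ^ 2 * R) :
    ∃ p ∈ Metric.ball p₀ R, IsMaxOn (logisticLik y) Set.univ p := by
  obtain ⟨p, hp, hmax⟩ := (isCompact_closedBall p₀ R).exists_isMaxOn
    ⟨p₀, Metric.mem_closedBall_self hR.le⟩ (continuous_logisticLik y).continuousOn
  obtain ⟨w, hw⟩ := exists_isBoxEquilibrium_of_isMaxOn hR hB hres hp hmax
  obtain ⟨c, hcu, hcv⟩ := hw.exists_shift_abs_lt hkι hkκ hD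
  have hmem : shift c p ∈ Metric.ball p₀ R := by
    refine (mem_ball_prod_pi hR).2 ⟨fun i ↦ ?_, fun j ↦ ?_⟩
    · simpa only [shift, Pi.sub_apply, sub_add_eq_add_sub] using hcu i
    · simpa only [shift, Pi.sub_apply, sub_right_comm] using hcv j
  have hlocal : IsLocalMax (logisticLik y) (shift c p) := by
    filter_upwards [Metric.isOpen_ball.mem_nhds hmem] with z hz
    exact (hmax (Metric.ball_subset_closedBall hz)).trans_eq (logisticLik_shift y c p).symm
  exact ⟨shift c p, hmem, fun z _ ↦
    IsMaxOn.of_isLocalMax_of_convex_univ hlocal (concaveOn_logisticLik y) z⟩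

theorem predictor_eq_of_isMaxOn_univ (hp : IsMaxOn (logisticLik y) Set.univ p)
    (hz : IsMaxOn (logisticLik y) Set.univ z) (i : ι) (j : κ) :
    predictor i j p = predictor i j z := by
  have hnonneg (i j) : 0 ≤ (Real.sigmoid (predictor i j z) - Real.sigmoid (predictor i j p)) *
      (predictor i j z - predictor i j p) := by
    rcases le_total (predictor i j p) (predictor i j z) with h | h
    · exact mul_nonneg (sub_nonneg.2 (Real.sigmoid_le h)) (sub_nonneg.2 h)
    · exact mul_nonneg_of_nonpos_of_nonpos (sub_nonpos.2 (Real.sigmoid_le h)) (sub_nonpos.2 h)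
  have hle : ∑ i, ∑ j, (Real.sigmoid (predictor i j z) - Real.sigmoid (predictor i j p)) *
      (predictor i j z - predictor i j p) ≤ 0 := by
    have h := add_nonpos
      (sum_residual_mul_nonpos_of_isMaxOn convex_univ (Set.mem_univ _) (Set.mem_univ z) hp)
      (sum_residual_mul_nonpos_of_isMaxOn convex_univ (Set.mem_univ _) (Set.mem_univ p) hz)
    simp only [← Finset.sum_add_distrib] at h
    refine le_of_eq_of_le (Finset.sum_congr rfl fun i _ ↦ Finset.sum_congr rfl fun j _ ↦ ?_) h
    rw [logisticResidual, logisticResidual]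
    ring
  have hrow := (Finset.sum_eq_zero_iff_of_nonneg fun i _ ↦ Finset.sum_nonneg fun j _ ↦
    hnonneg i j).1 (hle.antisymm (Finset.sum_nonneg fun i _ ↦ Finset.sum_nonneg fun j _ ↦
    hnonneg i j)) i (Finset.mem_univ i)
  have hterm := (Finset.sum_eq_zero_iff_of_nonneg fun j _ ↦ hnonneg i j).1 hrow j
    (Finset.mem_univ j)
  rcases mul_eq_zero.1 hterm with h | h
  · exact (Real.sigmoid_strictMono.injective (sub_eq_zero.1 h)).symm
  · exact (sub_eq_zero.1 h).symm

end Likelihood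

/-! ### Probability -/

theorem measureReal_lt_abs_le_of_hasSubgaussianMGF {Ω : Type*} {mΩ : MeasurableSpace Ω}
    {μ : Measure Ω} [IsFiniteMeasure μ] {X : Ω → ℝ} {c : NNReal} (h : HasSubgaussianMGF X c μ)
    {t : ℝ} (ht : 0 ≤ t) : μ.real {ω | t < |X ω|} ≤ 2 * Real.exp (-t ^ 2 / (2 * c)) :=
  calc μ.real {ω | t < |X ω|} ≤ μ.real ({ω | t ≤ X ω} ∪ {ω | t ≤ -X ω}) :=
        measureReal_mono fun ω hω ↦ by
          rcases lt_abs.1 (show t < |X ω| from hω) with h | h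
          exacts [Or.inl h.le, Or.inr h.le]
    _ ≤ μ.real {ω | t ≤ X ω} + μ.real {ω | t ≤ -X ω} := measureReal_union_le _ _
    _ ≤ 2 * Real.exp (-t ^ 2 / (2 * c)) := by
        rw [two_mul]
        exact add_le_add (h.measure_ge_le ht) (h.neg.measure_ge_le ht)

theorem tendsto_measure_one_of_tendsto_measure_compl_zero {Ω : ℕ → Type*}
    [∀ n, MeasurableSpace (Ω n)] {P : ∀ n, Measure (Ω n)} [∀ n, IsProbabilityMeasure (P n)]
    {s t : ∀ n, Set (Ω n)} (hs : Tendsto (fun n ↦ P n (s n)ᶜ) atTop (𝓝 0))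
    (hst : ∀ n, s n ⊆ t n) : Tendsto (fun n ↦ P n (t n)) atTop (𝓝 1) := by
  have hlim : Tendsto (fun n ↦ 1 - P n (s n)ᶜ) atTop (𝓝 1) := by
    simpa using ENNReal.Tendsto.sub tendsto_const_nhds hs (.inl ENNReal.one_ne_top)
  refine tendsto_of_tendsto_of_tendsto_of_le_of_le hlim tendsto_const_nhds (fun n ↦ ?_)
    fun n ↦ prob_le_one
  rw [tsub_le_iff_right]
  calc 1 = P n (s n ∪ (s n)ᶜ) := by rw [Set.union_compl_self, measure_univ]
    _ ≤ P n (s n) + P n (s n)ᶜ := measure_union_le _ _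
    _ ≤ P n (t n) + P n (s n)ᶜ := by gcongr; exact hst n

theorem isBigOInProbability_of_eventually_le {Ω : ℕ → Type*} [∀ n, MeasurableSpace (Ω n)]
    {P : ∀ n, Measure (Ω n)} {Y : ∀ n, Ω n → ℝ} {a : ℕ → ℝ} {M : ℝ} (hM : 0 < M)
    {s : ∀ n, Set (Ω n)} (hs : Tendsto (fun n ↦ P n (s n)ᶜ) atTop (𝓝 0))
    (hY : ∀ᶠ n in atTop, ∀ ω ∈ s n, |Y n ω| ≤ M * a n) : IsBigOInProbability P Y a := by
  refine fun ε hε ↦ ⟨M, hM, ?_⟩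
  filter_upwards [hY, hs.eventually_le_const (ENNReal.ofReal_pos.2 hε)] with n hYn hsn
  exact (measure_mono fun ω hω hωs ↦ (hYn ω hωs).not_gt hω).trans hsn

theorem IsBigOInProbability.isLittleOInProbability {Ω : ℕ → Type*} [∀ n, MeasurableSpace (Ω n)]
    {P : ∀ n, Measure (Ω n)} {Y : ∀ n, Ω n → ℝ} {a : ℕ → ℝ} (h : IsBigOInProbability P Y a)
    (ha : Tendsto a atTop (𝓝 0)) : IsLittleOInProbability P Y fun _ ↦ 1 := by
  intro δ hδ
  refine ENNReal.tendsto_nhds_zero.2 fun ε hε ↦ ?_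
  obtain ⟨r, -, hr, hrε⟩ := ENNReal.lt_iff_exists_real_btwn.1 hε
  obtain ⟨M, -, hM⟩ := h r (by simpa using hr)
  have hMa : Tendsto (fun n ↦ M * a n) atTop (𝓝 0) := by simpa using ha.const_mul M
  filter_upwards [hM, hMa.eventually_le_const hδ] with n hn hδn
  refine ((measure_mono fun ω hω ↦ ?_).trans hn).trans hrε.le
  exact hδn.trans_lt (by simpa using hω)

/-! ### The affiliation model -/

namespace Affiliation

variable {m n : ℕ} {x : Graph m n} {θ θ₁ θ₂ : Param m n}

/-- The row effects `α` and all `n` column effects `β`, including `β_n = 0`. -/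
def effects (θ : Param m n) : (Fin m → ℝ) × (Fin n → ℝ) := (alpha θ, beta θ)

/-- The parameter vector whose effects are those of `p`, shifted so that the last column effect
vanishes. -/
def normalize (hn : 1 ≤ n) (p : (Fin m → ℝ) × (Fin n → ℝ)) : Param m n :=
  let q := shift (p.2 ⟨n - 1, Nat.sub_lt hn one_pos⟩) p
  Sum.elim q.1 fun j ↦ q.2 (j.castLE (Nat.sub_le n 1))

theorem beta_last (hn : 1 ≤ n) (θ : Param m n) : beta θ ⟨n - 1, Nat.sub_lt hn one_pos⟩ = 0 := by
  simp [beta]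

theorem beta_castLE (θ : Param m n) (j : Fin (n - 1)) :
    beta θ (j.castLE (Nat.sub_le n 1)) = θ (Sum.inr j) := by
  simp [beta]

theorem effects_injective : Function.Injective (effects : Param m n → _) := by
  intro θ₁ θ₂ h
  funext k
  rcases k with i | j
  · exact congrFun (congrArg Prod.fst h) i
  · rw [← beta_castLE θ₁, ← beta_castLE θ₂]
    exact congrFun (congrArg Prod.snd h) _

theorem effects_normalize (hn : 1 ≤ n) (p : (Fin m → ℝ) × (Fin n → ℝ)) :
    effects (normalize hn p) = shift (p.2 ⟨n - 1, Nat.sub_lt hn one_pos⟩) p := by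
  refine Prod.ext rfl (funext fun j ↦ ?_)
  by_cases hj : j.1 < n - 1
  · simp [effects, beta, normalize, hj]
  · obtain rfl : j = ⟨n - 1, Nat.sub_lt hn one_pos⟩ := Fin.ext (show j.1 = n - 1 by omega)
    simp [effects, beta_last hn, shift]

theorem norm_effects_le (θ : Param m n) : ‖effects θ‖ ≤ ‖θ‖ := by
  refine norm_prod_le_iff.2 ⟨?_, ?_⟩ <;>
    refine (pi_norm_le_iff_of_nonneg (norm_nonneg θ)).2 fun k ↦ ?_
  · exact norm_le_pi_norm θ _
  · by_cases hk : k.1 < n - 1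
    · simpa [effects, beta, hk] using norm_le_pi_norm θ _
    · simp [effects, beta, hk]

theorem norm_normalize_sub_le (hn : 1 ≤ n) (p : (Fin m → ℝ) × (Fin n → ℝ)) (θ : Param m n) :
    ‖normalize hn p - θ‖ ≤ 2 * ‖p - effects θ‖ := by
  have hrow (i) : |p.1 i - alpha θ i| ≤ ‖p - effects θ‖ :=
    (norm_le_pi_norm (p - effects θ).1 i).trans (norm_fst_le _)
  have hcol (j) : |p.2 j - beta θ j| ≤ ‖p - effects θ‖ :=
    (norm_le_pi_norm (p - effects θ).2 j).trans (norm_snd_le _)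
  have hlast := hcol ⟨n - 1, Nat.sub_lt hn one_pos⟩
  rw [beta_last hn, sub_zero] at hlast
  refine (pi_norm_le_iff_of_nonneg (by positivity)).2 (Sum.rec (fun i ↦ ?_) fun j ↦ ?_)
  · calc |p.1 i + p.2 ⟨n - 1, _⟩ - alpha θ i| = |(p.1 i - alpha θ i) + p.2 ⟨n - 1, _⟩| := by
          rw [add_sub_right_comm]
      _ ≤ |p.1 i - alpha θ i| + |p.2 ⟨n - 1, _⟩| := abs_add_le _ _
      _ ≤ 2 * ‖p - effects θ‖ := by linarith [hrow i]
  · have hj := hcol (j.castLE (Nat.sub_le n 1))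
    rw [beta_castLE] at hj
    calc |p.2 (j.castLE _) - p.2 ⟨n - 1, _⟩ - θ (Sum.inr j)|
        = |(p.2 (j.castLE _) - θ (Sum.inr j)) - p.2 ⟨n - 1, _⟩| := by rw [sub_right_comm]
      _ ≤ |p.2 (j.castLE _) - θ (Sum.inr j)| + |p.2 ⟨n - 1, _⟩| := abs_sub _ _
      _ ≤ 2 * ‖p - effects θ‖ := by linarith

theorem logLikelihood_eq_logisticLik (x : Graph m n) (θ : Param m n) :
    logLikelihood x θ = logisticLik (entry x) (effects θ) := by
  simp only [logLikelihood, logisticLik, rowDegree, colDegree, effects, predictor_apply, add_mul,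
    Finset.sum_sub_distrib, Finset.sum_add_distrib, Finset.mul_sum]
  rw [Finset.sum_comm (f := fun j i ↦ beta θ j * entry x i j)]

theorem isMLE_iff_isMaxOn (hn : 1 ≤ n) :
    IsMLE x θ ↔ IsMaxOn (logisticLik (entry x)) Set.univ (effects θ) := by
  simp only [IsMLE, logLikelihood_eq_logisticLik, isMaxOn_univ_iff]
  refine ⟨fun h p ↦ ?_, fun h θ' ↦ h _⟩
  simpa only [effects_normalize, logisticLik_shift] using h (normalize hn p)

theorem IsMLE.unique (hm : 1 ≤ m) (hn : 1 ≤ n) (h₁ : IsMLE x θ₁) (h₂ : IsMLE x θ₂) : θ₁ = θ₂ := by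
  have hsum (i j) : alpha θ₁ i + beta θ₁ j = alpha θ₂ i + beta θ₂ j :=
    predictor_eq_of_isMaxOn_univ ((isMLE_iff_isMaxOn hn).1 h₁) ((isMLE_iff_isMaxOn hn).1 h₂) i j
  have halpha (i) : alpha θ₁ i = alpha θ₂ i := by
    simpa only [beta_last hn, add_zero] using hsum i ⟨n - 1, Nat.sub_lt hn one_pos⟩
  have hbeta (j) : beta θ₁ j = beta θ₂ j := by
    simpa only [halpha, add_right_inj] using hsum ⟨0, hm⟩ j
  exact effects_injective (Prod.ext (funext halpha) (funext hbeta))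

theorem exists_isMLE_norm_sub_le {D k : ℝ} (hk : 0 < k) (hkm : k ≤ m) (hkn : k ≤ n) (hD : 0 < D)
    (hres : HasResidualSumsLE (entry x) (effects θ) D)
    (hsmall : 32 * Real.exp (4 * (‖θ‖ + 1)) * D / k ≤ 1) :
    ∃ θ', IsMLE x θ' ∧ ‖θ' - θ‖ ≤ 2 * (32 * Real.exp (4 * (‖θ‖ + 1)) * D / k) := by
  have hn : 1 ≤ n := Nat.cast_pos.1 (hk.trans_le hkn)
  set R := 32 * Real.exp (4 * (‖θ‖ + 1)) * D / k with hR
  have hB (i j) : |predictor i j (effects θ)| + 2 * R ≤ 2 * (‖θ‖ + 1) := by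
    linarith [abs_predictor_le i j (effects θ), norm_effects_le θ]
  have hexp : Real.exp (-(2 * (‖θ‖ + 1))) ^ 2 * Real.exp (4 * (‖θ‖ + 1)) = 1 := by
    rw [← Real.exp_nat_mul, ← Real.exp_add, Real.exp_eq_one_iff]
    push_cast
    ring
  have hDR : 2 * k * (Real.exp (-(2 * (‖θ‖ + 1))) / 4) ^ 2 * R = 4 * D :=
    calc 2 * k * (Real.exp (-(2 * (‖θ‖ + 1))) / 4) ^ 2 * R
        = 4 * D * (Real.exp (-(2 * (‖θ‖ + 1))) ^ 2 * Real.exp (4 * (‖θ‖ + 1))) := by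
          rw [hR]
          field_simp
          ring
      _ = 4 * D := by rw [hexp, mul_one]
  obtain ⟨p, hp, hmax⟩ := exists_isMaxOn_univ_mem_ball (k := k) (by positivity) hB (by simpa)
    (by simpa) hres (by linarith)
  refine ⟨normalize hn p, (isMLE_iff_isMaxOn hn).2 ?_, ?_⟩
  · simpa only [effects_normalize, isMaxOn_univ_iff, logisticLik_shift] using hmax
  · exact (norm_normalize_sub_le hn p θ).trans (by gcongr; exact (mem_ball_iff_norm.1 hp).le)

theorem integral_entry (θ : Param m n) (i : Fin m) (j : Fin n) :
    ∫ x, entry x i j ∂law θ = Real.sigmoid (alpha θ i + beta θ j) := by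
  have heval := measurePreserving_eval (fun p : Fin m × Fin n ↦
    bernoulliMeasure true false (unitInterval.sigmoid (alpha θ p.1 + beta θ p.2))) (i, j)
  calc ∫ x, entry x i j ∂law θ
      = ∫ z : Bool, (if z then (1 : ℝ) else 0)
          ∂bernoulliMeasure true false (unitInterval.sigmoid (alpha θ i + beta θ j)) := by
        rw [← heval.map_eq, integral_map heval.measurable.aemeasurable
          (measurable_of_finite _).aestronglyMeasurable]
        rfl
    _ = Real.sigmoid (alpha θ i + beta θ j) := by
        simp [integral_bernoulliMeasure, unitInterval.sigmoid, Subtype.coind]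

theorem hasSubgaussianMGF_logisticResidual (θ : Param m n) (i : Fin m) (j : Fin n) :
    HasSubgaussianMGF (fun x ↦ logisticResidual (entry x) (effects θ) i j) (1 / 4) (law θ) := by
  have h := hasSubgaussianMGF_of_mem_Icc (μ := law θ) (X := fun x ↦ entry x i j) (a := 0) (b := 1)
    (measurable_of_finite _).aemeasurable
    (.of_forall fun x ↦ by unfold entry; split <;> simp)
  have hparam : (‖(1 : ℝ) - 0‖₊ / 2) ^ 2 = 1 / 4 := by norm_num
  rwa [integral_entry, hparam] at h

theorem iIndepFun_logisticResidual (θ : Param m n) :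
    iIndepFun (fun (p : Fin m × Fin n) x ↦ logisticResidual (entry x) (effects θ) p.1 p.2)
      (law θ) :=
  iIndepFun_pi (X := fun (p : Fin m × Fin n) (z : Bool) ↦
      (if z then (1 : ℝ) else 0) - Real.sigmoid (alpha θ p.1 + beta θ p.2))
    fun _ ↦ (measurable_of_finite _).aemeasurable

theorem law_real_lt_abs_sum_logisticResidual_le (θ : Param m n) (s : Finset (Fin m × Fin n))
    {D L : ℝ} (hD : 0 ≤ D) (hL : L * s.card ≤ 2 * D ^ 2) :
    (law θ).real {x | D < |∑ p ∈ s, logisticResidual (entry x) (effects θ) p.1 p.2|} ≤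
      2 * Real.exp (-L) := by
  rcases s.eq_empty_or_nonempty with rfl | hs
  · have hempty : {x : Graph m n | D < |∑ p ∈ (∅ : Finset (Fin m × Fin n)),
        logisticResidual (entry x) (effects θ) p.1 p.2|} = ∅ := by
      simp [hD.not_gt]
    rw [hempty, measureReal_empty]
    positivity
  refine (measureReal_lt_abs_le_of_hasSubgaussianMGF (HasSubgaussianMGF.sum_of_iIndepFun
    (iIndepFun_logisticResidual θ) fun p _ ↦ hasSubgaussianMGF_logisticResidual θ p.1 p.2)
    hD).trans ?_
  gcongr
  rw [neg_div, neg_le_neg_iff, Finset.sum_const, nsmul_eq_mul]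
  push_cast
  rw [le_div_iff₀ (by positivity)]
  linarith

theorem law_real_compl_hasResidualSumsLE_le (θ : Param m n) {D L : ℝ} (hD : 0 ≤ D)
    (hm : L * m ≤ 2 * D ^ 2) (hn : L * n ≤ 2 * D ^ 2) :
    (law θ).real {x | HasResidualSumsLE (entry x) (effects θ) D}ᶜ ≤
      (m + n) * (2 * Real.exp (-L)) := by
  let rowBad (i : Fin m) : Set (Graph m n) :=
    {x | D < |∑ j, logisticResidual (entry x) (effects θ) i j|}
  let colBad (j : Fin n) : Set (Graph m n) :=
    {x | D < |∑ i, logisticResidual (entry x) (effects θ) i j|}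
  have hrow (i) : (law θ).real (rowBad i) ≤ 2 * Real.exp (-L) := by
    simpa [rowBad, Finset.sum_product] using
      law_real_lt_abs_sum_logisticResidual_le θ ({i} ×ˢ Finset.univ) hD (by simpa using hn)
  have hcol (j) : (law θ).real (colBad j) ≤ 2 * Real.exp (-L) := by
    simpa [colBad, Finset.sum_product] using
      law_real_lt_abs_sum_logisticResidual_le θ (Finset.univ ×ˢ {j}) hD (by simpa using hm)
  have hcover : {x | HasResidualSumsLE (entry x) (effects θ) D}ᶜ =
      (⋃ i, rowBad i) ∪ ⋃ j, colBad j := by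
    ext x
    simp [HasResidualSumsLE, rowBad, colBad, imp_iff_not_or]
  calc (law θ).real {x | HasResidualSumsLE (entry x) (effects θ) D}ᶜ
      ≤ ∑ i, (law θ).real (rowBad i) + ∑ j, (law θ).real (colBad j) := by
        rw [hcover]
        exact (measureReal_union_le _ _).trans
          (add_le_add (measureReal_iUnion_fintype_le _) (measureReal_iUnion_fintype_le _))
    _ ≤ ∑ _i : Fin m, 2 * Real.exp (-L) + ∑ _j : Fin n, 2 * Real.exp (-L) := by
        gcongr with i _ j
        · exact hrow i
        · exact hcol j
    _ = (m + n) * (2 * Real.exp (-L)) := by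
        rw [Finset.sum_const, Finset.sum_const, Finset.card_fin, Finset.card_fin, nsmul_eq_mul,
          nsmul_eq_mul, add_mul]

/-- The observations for which some maximum likelihood estimate lies within `r` of `θ`. -/
def mleNear (θ : Param m n) (r : ℝ) : Set (Graph m n) :=
  {x | ∃ θ', IsMLE x θ' ∧ ‖θ' - θ‖ ≤ r}

/-- The rate `(log n)^{1/2} e^{γ t} / n^{1/2}`, where `t` stands for `‖θ*‖_∞`. -/
noncomputable def consistencyRate (γ t : ℝ) (n : ℕ) : ℝ :=
  √(Real.log n) * Real.exp (γ * t) / √n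

theorem tendsto_consistencyRate {γ τ : ℝ} (hγ : 0 ≤ γ) (hγτ : γ * τ < 1 / 2) {t : ℕ → ℝ}
    (ht : ∀ᶠ n : ℕ in atTop, t n ≤ τ * Real.log n) :
    Tendsto (fun n ↦ consistencyRate γ (t n) n) atTop (𝓝 0) := by
  have hlim : Tendsto (fun n : ℕ ↦ √(Real.log n) * Real.exp (-(1 / 2 - γ * τ) * Real.log n))
      atTop (𝓝 0) := by
    simp only [Real.sqrt_eq_rpow]
    exact (tendsto_rpow_mul_exp_neg_mul_atTop_nhds_zero _ _ (by linarith)).comp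
      (Real.tendsto_log_atTop.comp tendsto_natCast_atTop_atTop)
  refine squeeze_zero' (.of_forall fun n ↦ by unfold consistencyRate; positivity) ?_ hlim
  filter_upwards [ht, eventually_ge_atTop 1] with n htn hn
  have hsqrt : √(n : ℝ) = Real.exp (Real.log n / 2) := by
    rw [Real.exp_half, Real.exp_log (by exact_mod_cast hn)]
  rw [consistencyRate, mul_div_assoc, hsqrt, ← Real.exp_sub]
  gcongr
  linarith [mul_le_mul_of_nonneg_left htn hγ]

theorem tendsto_law_compl_hasResidualSumsLE {C : ℝ} (hC : 0 ≤ C) {m : ℕ → ℕ}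
    (hm : ∀ᶠ n : ℕ in atTop, (m n : ℝ) ≤ C * n) (θ : ∀ n, Param (m n) n) :
    Tendsto (fun n : ℕ ↦ law (θ n)
      {x | HasResidualSumsLE (entry x) (effects (θ n)) ((1 + C) * (√n * √(Real.log n)))}ᶜ)
      atTop (𝓝 0) := by
  rw [← ENNReal.tendsto_toReal_iff (fun n ↦ measure_ne_top _ _) ENNReal.zero_ne_top,
    ENNReal.toReal_zero]
  have hlim : Tendsto (fun n : ℕ ↦ 2 * (C + 1) * (n : ℝ)⁻¹) atTop (𝓝 0) := by
    simpa using tendsto_inv_atTop_nhds_zero_nat.const_mul (2 * (C + 1))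
  refine squeeze_zero' (.of_forall fun n ↦ ENNReal.toReal_nonneg) ?_ hlim
  filter_upwards [hm, eventually_ge_atTop 1] with n hmn hn
  have hn0 : (0 : ℝ) < n := by exact_mod_cast hn
  have hlog : 0 ≤ Real.log n := Real.log_natCast_nonneg n
  have hsq : 2 * ((1 + C) * (√n * √(Real.log n))) ^ 2 = 2 * Real.log n * ((1 + C) ^ 2 * n) := by
    rw [mul_pow, mul_pow, Real.sq_sqrt hn0.le, Real.sq_sqrt hlog]
    ring
  have hCsq : C ≤ (1 + C) ^ 2 ∧ 1 ≤ (1 + C) ^ 2 := by constructor <;> nlinarith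
  have hexp : Real.exp (-(2 * Real.log n)) = (n : ℝ)⁻¹ * (n : ℝ)⁻¹ := by
    rw [two_mul, neg_add, Real.exp_add, Real.exp_neg, Real.exp_log hn0]
  calc (law (θ n)).real
        {x | HasResidualSumsLE (entry x) (effects (θ n)) ((1 + C) * (√n * √(Real.log n)))}ᶜ
      ≤ (m n + n) * (2 * Real.exp (-(2 * Real.log n))) := by
        refine law_real_compl_hasResidualSumsLE_le (θ n) (by positivity) ?_ ?_ <;> rw [hsq] <;>
          gcongr
        · exact hmn.trans (by gcongr; exact hCsq.1)
        · exact le_mul_of_one_le_left hn0.le hCsq.2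
    _ ≤ (C * n + n) * (2 * Real.exp (-(2 * Real.log n))) := by gcongr
    _ = 2 * (C + 1) * (n : ℝ)⁻¹ := by
        rw [hexp]
        field_simp

theorem radius_eq_mul_consistencyRate (a C t : ℝ) (n : ℕ) :
    32 * Real.exp (4 * (t + 1)) * ((1 + C) * (√n * √(Real.log n))) / (a * n) =
      32 * Real.exp 4 * (1 + C) / a * consistencyRate 4 t n :=
  calc 32 * Real.exp (4 * (t + 1)) * ((1 + C) * (√n * √(Real.log n))) / (a * n)
      = 32 * Real.exp 4 * (1 + C) / a * (√(Real.log n) * Real.exp (4 * t) * (√n / n)) := by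
        rw [mul_add, mul_one, Real.exp_add]
        ring
    _ = 32 * Real.exp 4 * (1 + C) / a * consistencyRate 4 t n := by
        rw [Real.sqrt_div_self', mul_one_div, consistencyRate]

theorem setOf_hasResidualSumsLE_subset_mleNear {γ a C : ℝ} (hγ : 4 ≤ γ) (hC : 0 ≤ C) (ha : 0 < a)
    (hn : 2 ≤ n) (ham : a * n ≤ m) (han : a * n ≤ n)
    (hsmall : 32 * Real.exp 4 * (1 + C) / a * consistencyRate γ ‖θ‖ n ≤ 1) :
    {x | HasResidualSumsLE (entry x) (effects θ) ((1 + C) * (√n * √(Real.log n)))} ⊆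
      mleNear θ (2 * (32 * Real.exp 4 * (1 + C) / a) * consistencyRate γ ‖θ‖ n) := by
  intro x hx
  have hlog : 0 < Real.log n := Real.log_pos (by exact_mod_cast hn)
  have hradius :
      32 * Real.exp (4 * (‖θ‖ + 1)) * ((1 + C) * (√n * √(Real.log n))) / (a * n) ≤
        32 * Real.exp 4 * (1 + C) / a * consistencyRate γ ‖θ‖ n := by
    rw [radius_eq_mul_consistencyRate]
    unfold consistencyRate
    gcongr
  obtain ⟨θ', hmle, hdist⟩ := exists_isMLE_norm_sub_le (by positivity) ham han (by positivity) hx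
    (hradius.trans hsmall)
  exact ⟨θ', hmle, hdist.trans (by linarith)⟩

theorem exists_tendsto_law_compl_mleNear {γ τ c C : ℝ} (hγ : 4 ≤ γ) (hγτ : γ * τ < 1 / 2)
    (hc : 0 < c) {m : ℕ → ℕ}
    (hm : ∀ᶠ n : ℕ in atTop, c * (n : ℝ) ≤ (m n : ℝ) ∧ (m n : ℝ) ≤ C * (n : ℝ))
    {θ : ∀ n, Param (m n) n} (hθ : ∀ᶠ n : ℕ in atTop, ‖θ n‖ ≤ τ * Real.log n) :
    ∃ M, 0 < M ∧ Tendsto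
      (fun n ↦ law (θ n) (mleNear (θ n) (M * consistencyRate γ ‖θ n‖ n))ᶜ) atTop (𝓝 0) := by
  have hC : 0 ≤ C := by
    obtain ⟨n, hmn, hn⟩ := (hm.and (eventually_ge_atTop 1)).exists
    exact nonneg_of_mul_nonneg_left ((Nat.cast_nonneg _).trans hmn.2) (by exact_mod_cast hn)
  have hmin : 0 < min c 1 := lt_min hc one_pos
  have hsmall := ((tendsto_consistencyRate (by linarith) hγτ hθ).const_mul
    (32 * Real.exp 4 * (1 + C) / min c 1)).eventually_le_const (by simp : _ < (1 : ℝ))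
  refine ⟨2 * (32 * Real.exp 4 * (1 + C) / min c 1), by positivity,
    tendsto_of_tendsto_of_tendsto_of_le_of_le' tendsto_const_nhds
      (tendsto_law_compl_hasResidualSumsLE hC (hm.mono fun _ h ↦ h.2) θ)
      (.of_forall fun _ ↦ zero_le) ?_⟩
  filter_upwards [hm, hsmall, eventually_ge_atTop 2] with n hmn hsmalln hn
  refine measure_mono (Set.compl_subset_compl.2 ?_)
  exact setOf_hasResidualSumsLE_subset_mleNear hγ hC hmin hn
    (hmn.1.trans' (by gcongr; exact min_le_left _ _))
    (mul_le_of_le_one_left n.cast_nonneg (min_le_right _ _)) hsmalln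

end Affiliation

theorem theorem1_general {γ τ c C : ℝ} (hγ : 4 ≤ γ) (hγτ : γ * τ < 1 / 2) (hc : 0 < c)
    {m : ℕ → ℕ} (hm : ∀ᶠ n : ℕ in atTop, c * (n : ℝ) ≤ (m n : ℝ) ∧ (m n : ℝ) ≤ C * (n : ℝ))
    {θ : ∀ n, Affiliation.Param (m n) n} (hθ : ∀ᶠ n : ℕ in atTop, ‖θ n‖ ≤ τ * Real.log n) :
    Tendsto (fun n ↦ Affiliation.law (θ n) {x | ∃ θ', Affiliation.IsMLE x θ'}) atTop (𝓝 1) ∧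
      (∀ θhat : ∀ n, Affiliation.Graph (m n) n → Affiliation.Param (m n) n,
        (∀ n x, (∃ θ', Affiliation.IsMLE x θ') → Affiliation.IsMLE x (θhat n x)) →
        IsBigOInProbability (fun n ↦ Affiliation.law (θ n)) (fun n x ↦ ‖θhat n x - θ n‖)
          (fun n ↦ Affiliation.consistencyRate γ ‖θ n‖ n) ∧
        IsLittleOInProbability (fun n ↦ Affiliation.law (θ n)) (fun n x ↦ ‖θhat n x - θ n‖)
          (fun _ ↦ 1)) ∧
      Tendsto (fun n ↦ Affiliation.consistencyRate γ ‖θ n‖ n) atTop (𝓝 0) := by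
  have hrate := Affiliation.tendsto_consistencyRate (by linarith) hγτ hθ
  obtain ⟨M, hM, hnear⟩ := Affiliation.exists_tendsto_law_compl_mleNear hγ hγτ hc hm hθ
  refine ⟨tendsto_measure_one_of_tendsto_measure_compl_zero hnear
    fun n x ⟨θ', hθ', _⟩ ↦ ⟨θ', hθ'⟩, fun θhat hhat ↦ ?_, hrate⟩
  have hbigO : IsBigOInProbability (fun n ↦ Affiliation.law (θ n))
      (fun n x ↦ ‖θhat n x - θ n‖) (fun n ↦ Affiliation.consistencyRate γ ‖θ n‖ n) := by
    refine isBigOInProbability_of_eventually_le hM hnear ?_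
    filter_upwards [hm, eventually_ge_atTop 1] with n hmn hn x ⟨θ', hmle, hdist⟩
    have hm1 : 1 ≤ m n := Nat.cast_pos.1 (hmn.1.trans_lt' (by positivity))
    rw [(hhat n x ⟨θ', hmle⟩).unique hm1 hn hmle, abs_norm]
    exact hdist
  exact ⟨hbigO, hbigO.isLittleOInProbability hrate⟩

theorem theorem1 :
    -- consistency along an arbitrary sequence of models with `m n` rows and `n` columns
    (∀ (τ c C : ℝ), 0 < τ → τ < 1 / 24 → 0 < c → ∀ (m : ℕ → ℕ),
      (∀ᶠ n : ℕ in atTop, c * (n : ℝ) ≤ (m n : ℝ) ∧ (m n : ℝ) ≤ C * (n : ℝ)) →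
      ∀ (θ : ∀ n : ℕ, Affiliation.Param (m n) n),
      (∀ᶠ n : ℕ in atTop, ‖θ n‖ ≤ τ * Real.log (n : ℝ)) →
      -- the MLE exists with probability tending to one
      Tendsto (fun n : ℕ => Affiliation.law (θ n)
        {x | ∃ θ' : Affiliation.Param (m n) n, Affiliation.IsMLE x θ'}) atTop (𝓝 1) ∧
      -- `θhat n x` is the MLE whenever the MLE exists
      (∀ (θhat : ∀ n : ℕ, Affiliation.Graph (m n) n → Affiliation.Param (m n) n),
        (∀ (n : ℕ) (x : Affiliation.Graph (m n) n),
          (∃ θ' : Affiliation.Param (m n) n, Affiliation.IsMLE x θ') →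
            Affiliation.IsMLE x (θhat n x)) →
        IsBigOInProbability (fun n => Affiliation.law (θ n)) (fun n x => ‖θhat n x - θ n‖)
          (fun n => Real.sqrt (Real.log (n : ℝ)) * Real.exp (6 * ‖θ n‖) / Real.sqrt (n : ℝ)) ∧
        IsLittleOInProbability (fun n => Affiliation.law (θ n)) (fun n x => ‖θhat n x - θ n‖)
          (fun _ => 1)) ∧
      -- the rate itself tends to zero
      Tendsto (fun n : ℕ =>
        Real.sqrt (Real.log (n : ℝ)) * Real.exp (6 * ‖θ n‖) / Real.sqrt (n : ℝ)) atTop (𝓝 0)) ∧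
    -- uniqueness of the MLE, for every size and every observation
    (∀ (m n : ℕ), 1 ≤ m → 1 ≤ n → ∀ (x : Affiliation.Graph m n)
      (θ₁ θ₂ : Affiliation.Param m n),
      Affiliation.IsMLE x θ₁ → Affiliation.IsMLE x θ₂ → θ₁ = θ₂) :=
  ⟨fun _ _ _ _ hτ hc _ hm _ hθ ↦ theorem1_general (by norm_num) (by linarith) hc hm hθ,
    fun _ _ hm hn _ _ _ h₁ h₂ ↦ h₁.unique hm hn h₂⟩
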